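/- Let $N\ge 1$, $s\in(1/2,1)$, let $\Omega\subset\mathbb{R}^N$ be a bounded domain of class $C^2$, and let $g_1,g_2:\mathbb{R}^N\setminus\Omega\to\mathbb{R}$ be continuous and bounded. For a function $u$ on $\mathbb{R}^N$ define the fractional eigenvalues $$\Lambda_i^s u(x)=\sup_{\dim S=N-i+1}\ \inf_{z\in S,\,|z|=1}\ \mathrm{p.v.}\!\int_{\mathbb{R}}\frac{u(x+tz)-u(x)}{|t|^{1+2s}}\,dt,\qquad i=1,\dots,N,$$ where $S$ ranges over the linear subspaces of $\mathbb{R}^N$ (a positive normalizing constant $c(s)$ in front of the integral is irrelevant), and consider the Dirichlet problems $$\text{(T)}\quad \sum_{i=1}^N\Lambda_i^s u=0\ \text{ in }\Omega,\quad u=g\ \text{ in }\mathbb{R}^N\setminus\Omega;\qquad\qquad \text{(M)}\quad \Lambda_1^s u+\Lambda_N^s u=0\ \text{ in }\Omega,\quad u=g\ \text{ in }\mathbb{R}^N\setminus\Omega$$ for the trace and for the mid-range fractional Laplacian. Solutions are understood in the following viscosity sense. Let $u^g$ (resp. $u_g$) be equal to $u$ in $\Omega$, to $g$ in $\mathbb{R}^N\setminus\overline\Omega$,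 and to $\max\{u,g\}$ (resp. $\min\{u,g\}$) on $\partial\Omega$. For $\delta>0$, $|z|=1$ and $\phi\in C^2(\mathbb{R}^N)$ put $$E_{z,\delta}(w,\phi,x)=\mathrm{p.v.}\!\int_{-\delta}^{\delta}\frac{\phi(x+tz)-\phi(x)}{|t|^{1+2s}}\,dt+\int_{|t|\ge\delta}\frac{w(x+tz)-w(x)}{|t|^{1+2s}}\,dt,$$ and $$E_\delta(w,\phi,x)=-\sum_{i=1}^N\sup_{\dim S=N-i+1}\ \inf_{z\in S,\,|z|=1}E_{z,\delta}(w,\phi,x)\ \text{ for (T)},\qquad E_\delta(w,\phi,x)=-\Big[\inf_{|z|=1}E_{z,\delta}(w,\phi,x)+\sup_{|z|=1}E_{z,\delta}(w,\phi,x)\Big]\ \text{ for (M)}.$$ A bounded upper semicontinuous $u:\mathbb{R}^N\to\mathbb{R}$ is a subsolution if $u\le g$ in $\mathbb{R}^N\setminus\overline\Omega$ and, whenever $\delta>0$, $\phi\in C^2(\mathbb{R}^N)$ and $x_0$ is a maximum point of $u-\phi$ in $B_\delta(x_0)$, one has $E_\delta(u^g,\phi,x_0)\le 0$ if $x_0\in\Omega$,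 and $\min\{E_\delta(u^g,\phi,x_0),\,u(x_0)-g(x_0)\}\le 0$ if $x_0\in\partial\Omega$. A bounded lower semicontinuous $u:\mathbb{R}^N\to\mathbb{R}$ is a supersolution if $u\ge g$ in $\mathbb{R}^N\setminus\overline\Omega$ and, whenever $\delta>0$, $\phi\in C^2(\mathbb{R}^N)$ and $x_0$ is a minimum point of $u-\phi$ in $B_\delta(x_0)$, one has $E_\delta(u_g,\phi,x_0)\ge 0$ if $x_0\in\Omega$, and $\max\{E_\delta(u_g,\phi,x_0),\,u(x_0)-g(x_0)\}\ge 0$ if $x_0\in\partial\Omega$. A solution is a function that is both a subsolution and a supersolution. Let $u_1$ and $u_2$ be viscosity solutions of (T) with exterior data $g_1$ and $g_2$ respectively, or let $u_1$ and $u_2$ be viscosity solutions of (M) with exterior data $g_1$ and $g_2$ respectively. Then: 1. if $g_1\ge g_2$ in $\mathbb{R}^N\setminus\Omega$, then $u_1\ge u_2$ in $\mathbb{R}^N$ (in particular in $\Omega$); 2. $\|u_1-u_2\|_{L^\infty(\Omega)}\le\|g_1-g_2\|_{L^\infty(\mathbb{R}^N\setminus\Omega)}$. -/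

import Mathlib

open Set Filter Topology MeasureTheory

noncomputable section

namespace FracTrace

/-- A bounded domain of class `C²` in `ℝ^N`: a bounded, nonempty, connected open set that near each
boundary point is the sublevel set `{ρ < 0}` of a `C²` function with non-vanishing derivative. -/
structure IsBoundedC2Domain {N : ℕ} (Ω : Set (EuclideanSpace ℝ (Fin N))) : Prop where
  isOpen : IsOpen Ω
  isConnected : IsConnected Ω
  isBounded : Bornology.IsBounded Ω
  c2_boundary : ∀ x₀ ∈ frontier Ω, ∃ (U : Set (EuclideanSpace ℝ (Fin N)))
    (ρ : EuclideanSpace ℝ (Fin N) → ℝ),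
    IsOpen U ∧ x₀ ∈ U ∧ ContDiffOn ℝ 2 ρ U ∧ (∀ x ∈ U, fderiv ℝ ρ x ≠ 0) ∧
      Ω ∩ U = {x ∈ U | ρ x < 0}

/-- An exterior datum: a function that is continuous and bounded on `ℝ^N \ Ω`.
Its values inside `Ω` are never used. -/
structure IsExteriorDatum {N : ℕ} (Ω : Set (EuclideanSpace ℝ (Fin N)))
    (g : EuclideanSpace ℝ (Fin N) → ℝ) : Prop where
  continuousOn : ContinuousOn g Ωᶜ
  bounded : ∃ C : ℝ, ∀ x ∈ Ωᶜ, |g x| ≤ C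

open Classical in
/-- The upper `g`-extension `u^g`: it is `u` in `Ω`, `g` outside the closure of `Ω`, and
`max u g` on the boundary of `Ω`. -/
def upperExt {N : ℕ} (Ω : Set (EuclideanSpace ℝ (Fin N)))
    (g u : EuclideanSpace ℝ (Fin N) → ℝ) (x : EuclideanSpace ℝ (Fin N)) : ℝ :=
  if x ∈ Ω then u x else if x ∈ frontier Ω then max (u x) (g x) else g x

open Classical in
/-- The lower `g`-extension `u_g`: as `u^g`, with `min u g` on the boundary of `Ω`. -/
def lowerExt {N : ℕ} (Ω : Set (EuclideanSpace ℝ (Fin N)))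
    (g u : EuclideanSpace ℝ (Fin N) → ℝ) (x : EuclideanSpace ℝ (Fin N)) : ℝ :=
  if x ∈ Ω then u x else if x ∈ frontier Ω then min (u x) (g x) else g x

/-- The inner part, over `|t| < δ`, of the one-dimensional fractional derivative of order `2s` at
`x` in the direction `z`, in the sense of the principal value. -/
def innerPart {N : ℕ} (s δ : ℝ) (φ : EuclideanSpace ℝ (Fin N) → ℝ)
    (x z : EuclideanSpace ℝ (Fin N)) : ℝ :=
  limUnder (𝓝[>] (0 : ℝ)) fun ε : ℝ =>
    ∫ t in {t : ℝ | ε ≤ |t| ∧ |t| < δ}, (φ (x + t • z) - φ x) / |t| ^ (1 + 2 * s)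

/-- The outer part, over `|t| ≥ δ`. -/
def outerPart {N : ℕ} (s δ : ℝ) (w : EuclideanSpace ℝ (Fin N) → ℝ)
    (x z : EuclideanSpace ℝ (Fin N)) : ℝ :=
  ∫ t in {t : ℝ | δ ≤ |t|}, (w (x + t • z) - w x) / |t| ^ (1 + 2 * s)

/-- `E_{z,δ}(w, φ, x)`: the test function `φ` is used for `|t| < δ`, and `w` for `|t| ≥ δ`. -/
def dirEval {N : ℕ} (s δ : ℝ) (w φ : EuclideanSpace ℝ (Fin N) → ℝ)
    (x z : EuclideanSpace ℝ (Fin N)) : ℝ :=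
  innerPart s δ φ x z + outerPart s δ w x z

/-- The mid-range combination of a function `F` of the direction (without the factor `1/2`):
minus the sum of its infimum and its supremum over the unit sphere. -/
def midRangeComb {N : ℕ} (F : EuclideanSpace ℝ (Fin N) → ℝ) : ℝ :=
  -((⨅ z : {z : EuclideanSpace ℝ (Fin N) // ‖z‖ = 1}, F z) +
    ⨆ z : {z : EuclideanSpace ℝ (Fin N) // ‖z‖ = 1}, F z)

/-- The trace combination of a function `F` of the direction: minus the sum over `i = 1, …, N` of
the sup-inf of `F` over the unit spheres of the subspaces of dimension `N - i + 1`. -/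
def traceComb {N : ℕ} (F : EuclideanSpace ℝ (Fin N) → ℝ) : ℝ :=
  -∑ i ∈ Finset.Icc 1 N,
    ⨆ S : {S : Submodule ℝ (EuclideanSpace ℝ (Fin N)) // Module.finrank ℝ S = N - i + 1},
      ⨅ z : {z : EuclideanSpace ℝ (Fin N) // z ∈ S.1 ∧ ‖z‖ = 1}, F z

/-- Viscosity subsolution of the Dirichlet problem with exterior datum `g` in `Ω`, for the operator
that combines the directional derivatives through `A`. -/
structure IsViscositySubsolution {N : ℕ} (A : (EuclideanSpace ℝ (Fin N) → ℝ) → ℝ) (s : ℝ)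
    (Ω : Set (EuclideanSpace ℝ (Fin N))) (g u : EuclideanSpace ℝ (Fin N) → ℝ) : Prop where
  bounded : ∃ C : ℝ, ∀ x, |u x| ≤ C
  upperSemicontinuous : UpperSemicontinuous u
  le_exterior : ∀ x ∉ closure Ω, u x ≤ g x
  interior_test : ∀ δ : ℝ, 0 < δ → ∀ φ : EuclideanSpace ℝ (Fin N) → ℝ, ContDiff ℝ 2 φ →
    ∀ x₀ ∈ Ω, IsMaxOn (fun y => u y - φ y) (Metric.ball x₀ δ) x₀ →
      A (dirEval s δ (upperExt Ω g u) φ x₀) ≤ 0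
  boundary_test : ∀ δ : ℝ, 0 < δ → ∀ φ : EuclideanSpace ℝ (Fin N) → ℝ, ContDiff ℝ 2 φ →
    ∀ x₀ ∈ frontier Ω, IsMaxOn (fun y => u y - φ y) (Metric.ball x₀ δ) x₀ →
      min (A (dirEval s δ (upperExt Ω g u) φ x₀)) (u x₀ - g x₀) ≤ 0

/-- Viscosity supersolution: the reversed inequalities, with the lower `g`-extension. -/
structure IsViscositySupersolution {N : ℕ} (A : (EuclideanSpace ℝ (Fin N) → ℝ) → ℝ) (s : ℝ)
    (Ω : Set (EuclideanSpace ℝ (Fin N))) (g u : EuclideanSpace ℝ (Fin N) → ℝ) : Prop where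
  bounded : ∃ C : ℝ, ∀ x, |u x| ≤ C
  lowerSemicontinuous : LowerSemicontinuous u
  ge_exterior : ∀ x ∉ closure Ω, g x ≤ u x
  interior_test : ∀ δ : ℝ, 0 < δ → ∀ φ : EuclideanSpace ℝ (Fin N) → ℝ, ContDiff ℝ 2 φ →
    ∀ x₀ ∈ Ω, IsMinOn (fun y => u y - φ y) (Metric.ball x₀ δ) x₀ →
      0 ≤ A (dirEval s δ (lowerExt Ω g u) φ x₀)
  boundary_test : ∀ δ : ℝ, 0 < δ → ∀ φ : EuclideanSpace ℝ (Fin N) → ℝ, ContDiff ℝ 2 φ →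
    ∀ x₀ ∈ frontier Ω, IsMinOn (fun y => u y - φ y) (Metric.ball x₀ δ) x₀ →
      0 ≤ max (A (dirEval s δ (lowerExt Ω g u) φ x₀)) (u x₀ - g x₀)

/-- Viscosity solution of the Dirichlet problem for the trace fractional Laplacian:
`Λ₁ˢu + ⋯ + Λ_Nˢu = 0` in `Ω`, `u = g` in `ℝ^N \ Ω`. -/
def IsTraceSolution {N : ℕ} (s : ℝ) (Ω : Set (EuclideanSpace ℝ (Fin N)))
    (g u : EuclideanSpace ℝ (Fin N) → ℝ) : Prop :=
  IsViscositySubsolution traceComb s Ω g u ∧ IsViscositySupersolution traceComb s Ω g u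

/-- Viscosity solution of the Dirichlet problem for the mid-range fractional Laplacian:
`Λ₁ˢu + Λ_Nˢu = 0` in `Ω`, `u = g` in `ℝ^N \ Ω`. -/
def IsMidRangeSolution {N : ℕ} (s : ℝ) (Ω : Set (EuclideanSpace ℝ (Fin N)))
    (g u : EuclideanSpace ℝ (Fin N) → ℝ) : Prop :=
  IsViscositySubsolution midRangeComb s Ω g u ∧ IsViscositySupersolution midRangeComb s Ω g u

end FracTrace

end

namespace FracTrace

/-! ### Integrals of even kernels on the line -/

/-! A solution is both a subsolution and a supersolution, hence both upper and lower semicontinuous,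
hence continuous on the whole space. It equals `g` off `closure Ω`, and since the boundary is
regular every point of `Ωᶜ` is a limit of such points; so `u = g` on `Ωᶜ`, both `g`-extensions are
`u` itself, and the boundary tests are never needed (`eqOn_compl_of_solution`).

What remains is comparison for continuous bounded `v`, `u` with `v ≤ u` off `Ω`
(`comparison_of_continuous`), by doubling variables. Suppose `v - u = M > 0` somewhere, and maximize
`v x - u y - k ‖x - y‖ ^ 2` over a large ball, with `k` large enough that the moduli of continuity
put the maximum point `(x₀, y₀)` in `Ω × Ω`. Moving both points by the same `t • z` leaves the
penalty unchanged, so the increments of `v` at `x₀` are at most those of `u` at `y₀`. Every line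
leaves the bounded set `Ω`, and there `v ≤ u` makes this inequality strict by `M / 2`. The nonlocal
operator sees that gain, uniformly in `z`, and it outweighs the far tail and the quadratic test
functions on `|t| < δ`. Both combinations are strictly decreasing under such a uniform gain, which
contradicts the two viscosity inequalities.

Constants are invisible to the operator, so comparison with `u₁ + D` gives both conclusions. -/

theorem integrable_comp_abs {f : ℝ → ℝ} (hf : IntegrableOn f (Ioi 0)) :
    Integrable fun t => f |t| := by
  have hpos : IntegrableOn (fun t => f |t|) (Ioi 0) :=
    hf.congr_fun (fun t ht => by rw [abs_of_pos ht]) measurableSet_Ioi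
  have hneg : IntegrableOn (fun t => f |t|) (Iic 0) := by
    rw [← Measure.map_neg_eq_self (volume : Measure ℝ)]
    have m : MeasurableEmbedding fun x : ℝ => -x := (Homeomorph.neg ℝ).measurableEmbedding
    rw [m.integrableOn_map_iff]
    simp_rw [Function.comp_def, abs_neg, neg_preimage, neg_Iic, neg_zero]
    exact Iff.mpr integrableOn_Ici_iff_integrableOn_Ioi hpos
  rw [← integrableOn_univ, ← Iic_union_Ioi (a := (0 : ℝ))]
  exact hneg.union hpos

theorem measurableSet_le_abs (a : ℝ) : MeasurableSet {t : ℝ | a ≤ |t|} :=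
  measurableSet_le measurable_const continuous_abs.measurable

theorem measurableSet_abs_lt (a : ℝ) : MeasurableSet {t : ℝ | |t| < a} :=
  measurableSet_lt continuous_abs.measurable measurable_const

theorem integrableOn_one_div_abs_rpow {p a : ℝ} (hp : 1 < p) (ha : 0 < a) :
    IntegrableOn (fun t : ℝ => 1 / |t| ^ p) {t | a ≤ |t|} := by
  rw [← integrable_indicator_iff (measurableSet_le_abs a)]
  have h : IntegrableOn ((Ici a).indicator fun t : ℝ => 1 / t ^ p) (Ioi 0) := by
    apply Integrable.integrableOn
    rw [integrable_indicator_iff measurableSet_Ici]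
    refine (Iff.mpr integrableOn_Ici_iff_integrableOn_Ioi
      (integrableOn_Ioi_rpow_of_lt (a := -p) (by linarith) ha)).congr_fun (fun t ht => ?_)
      measurableSet_Ici
    simp [Real.rpow_neg (ha.le.trans ht)]
  exact integrable_comp_abs h

theorem integrableOn_sq_div_abs_rpow {p a : ℝ} (hp : p < 3) :
    IntegrableOn (fun t : ℝ => t ^ 2 / |t| ^ p) {t | |t| < a} := by
  rw [← integrable_indicator_iff (measurableSet_abs_lt a)]
  have h : IntegrableOn ((Iio a).indicator fun t : ℝ => t ^ 2 / t ^ p) (Ioi 0) := by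
    rw [IntegrableOn, integrable_indicator_iff measurableSet_Iio, IntegrableOn,
      Measure.restrict_restrict measurableSet_Iio]
    have hi : IntegrableOn (fun t : ℝ => t ^ (2 - p)) (Ioc 0 a) :=
      (intervalIntegral.intervalIntegrable_rpow' (a := 0) (b := a) (by linarith)).1
    refine (hi.mono_set (s := Iio a ∩ Ioi 0) fun t ht => ⟨ht.2, ht.1.le⟩).congr_fun
      (fun t ht => ?_) (measurableSet_Iio.inter measurableSet_Ioi)
    have ht0 : 0 < t := ht.2
    simp [Real.rpow_sub ht0]
  refine (integrable_comp_abs h).congr (Eventually.of_forall fun t => ?_)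
  simp [indicator]

theorem tendsto_setIntegral_abs_lt {p : ℝ} (hp : p < 3) :
    Tendsto (fun δ : ℝ => ∫ t in {t : ℝ | |t| < δ}, t ^ 2 / |t| ^ p) (𝓝[>] 0) (𝓝 0) := by
  have hI : Integrable (fun t : ℝ => t ^ 2 / |t| ^ p) (volume.restrict {t | |t| < 1}) :=
    integrableOn_sq_div_abs_rpow hp
  have hvol : Tendsto (fun δ : ℝ => (volume.restrict {t : ℝ | |t| < 1}) {t : ℝ | |t| < δ})
      (𝓝[>] 0) (𝓝 0) := by
    have h2 : Tendsto (fun δ : ℝ => ENNReal.ofReal (2 * δ)) (𝓝[>] 0) (𝓝 0) := by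
      have : Tendsto (fun δ : ℝ => ENNReal.ofReal (2 * δ)) (𝓝 0) (𝓝 (ENNReal.ofReal (2 * 0))) :=
        (ENNReal.continuous_ofReal.comp (continuous_const_mul 2)).tendsto 0
      simpa using this.mono_left nhdsWithin_le_nhds
    refine tendsto_of_tendsto_of_tendsto_of_le_of_le tendsto_const_nhds h2 (fun _ => zero_le)
      fun δ => (Measure.restrict_apply_le _ _).trans ?_
    have : {t : ℝ | |t| < δ} = Metric.ball 0 δ := by ext; simp
    rw [this, Real.volume_ball]
  refine (hI.tendsto_setIntegral_nhds_zero hvol).congr' ?_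
  filter_upwards [Ioo_mem_nhdsGT one_pos] with δ hδ
  rw [Measure.restrict_restrict (measurableSet_abs_lt δ)]
  congr 2
  ext t
  simpa using fun h : |t| < δ => h.trans hδ.2

theorem tendsto_setIntegral_le_abs {p : ℝ} (hp : 1 < p) :
    Tendsto (fun n : ℕ => ∫ t in {t : ℝ | (n : ℝ) ≤ |t|}, 1 / |t| ^ p) atTop (𝓝 0) := by
  have h := tendsto_setIntegral_of_antitone (μ := volume) (f := fun t : ℝ => 1 / |t| ^ p)
    (s := fun n : ℕ => {t : ℝ | (n : ℝ) ≤ |t|}) (fun n => measurableSet_le_abs n)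
    (fun m n hmn t (ht : (n : ℝ) ≤ |t|) => (Nat.cast_le.mpr hmn).trans ht)
    ⟨1, integrableOn_one_div_abs_rpow hp (by simp)⟩
  have he : ⋂ n : ℕ, {t : ℝ | (n : ℝ) ≤ |t|} = ∅ := by
    refine eq_empty_of_forall_notMem fun t ht => ?_
    obtain ⟨n, hn⟩ := exists_nat_gt |t|
    exact absurd (mem_iInter.mp ht n) (not_le.mpr hn)
  simpa [he] using h

theorem setIntegral_le_abs_pos {p a : ℝ} (hp : 1 < p) (ha : 0 < a) :
    0 < ∫ t in {t : ℝ | a ≤ |t|}, 1 / |t| ^ p := by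
  rw [setIntegral_pos_iff_support_of_nonneg_ae (Eventually.of_forall fun t => by positivity)
    (integrableOn_one_div_abs_rpow hp ha)]
  refine lt_of_lt_of_le ?_ (measure_mono (s := Ioo a (a + 1)) fun t ht => ⟨?_, ?_⟩)
  · simp
  · have : 0 < |t| := abs_pos.mpr (ha.trans ht.1).ne'
    simp only [Function.mem_support]
    positivity
  · exact ht.1.le.trans (le_abs_self t)

theorem setIntegral_eq_zero_of_odd {f : ℝ → ℝ} {S : Set ℝ} (hS : MeasurableSet S)
    (hneg : ∀ t, -t ∈ S ↔ t ∈ S) (hf : ∀ t, f (-t) = -f t) : ∫ t in S, f t = 0 := by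
  rw [← integral_indicator hS]
  have h := integral_neg_eq_self (S.indicator f) (volume : Measure ℝ)
  have h2 : (fun t => S.indicator f (-t)) = fun t => -S.indicator f t := by
    ext t
    by_cases ht : t ∈ S
    · rw [indicator_of_mem ht, indicator_of_mem ((hneg t).mpr ht), hf]
    · rw [indicator_of_notMem ht, indicator_of_notMem (mt (hneg t).mp ht), neg_zero]
  rw [h2, integral_neg] at h
  linarith

/-! ### The directional operators on test functions and bounded continuous functions -/

variable {N : ℕ}

/-- Expanding the square leaves a term linear in `t`, which is odd and cancels on each symmetric
truncation, and a term `k * t ^ 2`, integrable against the kernel because `s < 1`. The principal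
value therefore exists, so `limUnder` takes no default value, and it depends on none of `x`, `y`,
`z`. -/
theorem innerPart_sq_dist {s : ℝ} (hs' : s < 1) {δ : ℝ} (k c : ℝ)
    (x y z : EuclideanSpace ℝ (Fin N)) (hz : ‖z‖ = 1) :
    innerPart s δ (fun w => c + k * ‖w - y‖ ^ 2) x z =
      k * ∫ t in {t : ℝ | |t| < δ}, t ^ 2 / |t| ^ (1 + 2 * s) := by
  set p := 1 + 2 * s with hp
  have hp3 : p < 3 := by linarith
  have hq : ∀ a, IntegrableOn (fun t : ℝ => t ^ 2 / |t| ^ p) {t | |t| < a} :=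
    fun a => integrableOn_sq_div_abs_rpow hp3
  refine Tendsto.limUnder_eq ?_
  have hlim : Tendsto (fun ε : ℝ => k * ((∫ t in {t : ℝ | |t| < δ}, t ^ 2 / |t| ^ p) -
      ∫ t in {t : ℝ | |t| < ε}, t ^ 2 / |t| ^ p)) (𝓝[>] 0)
      (𝓝 (k * ∫ t in {t : ℝ | |t| < δ}, t ^ 2 / |t| ^ p)) := by
    have := (tendsto_const_nhds (x := ∫ t in {t : ℝ | |t| < δ}, t ^ 2 / |t| ^ p)).sub
      (tendsto_setIntegral_abs_lt hp3)
    simpa using this.const_mul k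
  rcases le_or_gt δ 0 with hδ | hδ
  · have h0 : {t : ℝ | |t| < δ} = ∅ :=
      eq_empty_of_forall_notMem fun t ht => absurd (ht.trans_le hδ) (not_lt.mpr (abs_nonneg t))
    have h1 : ∀ ε : ℝ, {t : ℝ | ε ≤ |t| ∧ |t| < δ} = ∅ := fun ε =>
      eq_empty_of_forall_notMem fun t ht =>
        absurd (ht.2.trans_le hδ) (not_lt.mpr (abs_nonneg t))
    simp [h0, h1]
  refine hlim.congr' ?_
  filter_upwards [Ioo_mem_nhdsGT hδ] with ε hε
  have hS : MeasurableSet {t : ℝ | ε ≤ |t| ∧ |t| < δ} :=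
    (measurableSet_le_abs ε).inter (measurableSet_abs_lt δ)
  have hdiff : {t : ℝ | ε ≤ |t| ∧ |t| < δ} = {t : ℝ | |t| < δ} \ {t : ℝ | |t| < ε} := by
    ext t
    simp [and_comm]
  have hsub : {t : ℝ | |t| < ε} ⊆ {t : ℝ | |t| < δ} := fun t (ht : |t| < ε) => ht.trans hε.2
  rw [← setIntegral_sdiff (measurableSet_abs_lt ε) (hq δ) hsub, ← hdiff, ← integral_const_mul]
  have hodd : ∫ t in {t : ℝ | ε ≤ |t| ∧ |t| < δ}, (2 * k * inner ℝ (x - y) z) * (t / |t| ^ p) = 0 :=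
    setIntegral_eq_zero_of_odd hS (fun t => by simp) fun t => by rw [abs_neg]; ring
  have hint : IntegrableOn (fun t : ℝ => (2 * k * inner ℝ (x - y) z) * (t / |t| ^ p))
      {t : ℝ | ε ≤ |t| ∧ |t| < δ} := by
    have hc : IsCompact {t : ℝ | ε ≤ |t| ∧ |t| ≤ δ} := by
      refine (isCompact_Icc (a := -δ) (b := δ)).of_isClosed_subset
        ((isClosed_le continuous_const continuous_abs).inter
          (isClosed_le continuous_abs continuous_const)) fun t ht => abs_le.mp ht.2
    refine (ContinuousOn.integrableOn_compact hc ?_).mono_set fun t ht => ⟨ht.1, ht.2.le⟩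
    refine continuousOn_const.mul (continuousOn_id.div ?_ fun t ht => ?_)
    · exact continuous_abs.continuousOn.rpow_const fun t ht => Or.inl (hε.1.trans_le ht.1).ne'
    · exact (Real.rpow_pos_of_pos (hε.1.trans_le ht.1) p).ne'
  have hint2 : IntegrableOn (fun t : ℝ => k * (t ^ 2 / |t| ^ p)) {t : ℝ | ε ≤ |t| ∧ |t| < δ} :=
    ((hq δ).mono_set fun t ht => ht.2).const_mul k
  rw [← zero_add (∫ t in {t : ℝ | ε ≤ |t| ∧ |t| < δ}, k * (t ^ 2 / |t| ^ p)), ← hodd,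
    ← integral_add hint hint2]
  refine setIntegral_congr_fun hS fun t ht => ?_
  have hexp : ‖x + t • z - y‖ ^ 2 = ‖x - y‖ ^ 2 + 2 * (t * inner ℝ (x - y) z) + t ^ 2 := by
    rw [show x + t • z - y = (x - y) + t • z by abel, norm_add_sq_real, inner_smul_right,
      norm_smul, hz]
    simp
  simp only [hexp]
  ring

theorem integrableOn_outer {s δ : ℝ} (hs : 0 < s) (hδ : 0 < δ)
    {w : EuclideanSpace ℝ (Fin N) → ℝ} (hw : Continuous w) {C : ℝ} (hC : ∀ x, |w x| ≤ C)
    (x z : EuclideanSpace ℝ (Fin N)) :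
    IntegrableOn (fun t : ℝ => (w (x + t • z) - w x) / |t| ^ (1 + 2 * s)) {t | δ ≤ |t|} := by
  refine ((integrableOn_one_div_abs_rpow (p := 1 + 2 * s) (by linarith) hδ).const_mul
    (2 * C)).mono' ?_ (Eventually.of_forall fun t => ?_)
  · refine Measurable.aestronglyMeasurable (Measurable.div ?_ ?_)
    · exact Continuous.measurable (by fun_prop)
    · exact continuous_abs.measurable.pow_const _
  · have h1 := abs_le.mp (hC (x + t • z))
    have h2 := abs_le.mp (hC x)
    have h3 : 0 ≤ |t| ^ (1 + 2 * s) := by positivity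
    rw [Real.norm_eq_abs, abs_div, abs_of_nonneg h3, mul_one_div]
    gcongr
    exact abs_le.mpr ⟨by linarith, by linarith⟩

theorem abs_outerPart_le {s δ : ℝ} (hs : 0 < s) (hδ : 0 < δ)
    {w : EuclideanSpace ℝ (Fin N) → ℝ} {C : ℝ} (hC : ∀ x, |w x| ≤ C)
    (x z : EuclideanSpace ℝ (Fin N)) :
    |outerPart s δ w x z| ≤ 2 * C * ∫ t in {t : ℝ | δ ≤ |t|}, 1 / |t| ^ (1 + 2 * s) := by
  rw [← integral_const_mul, ← Real.norm_eq_abs, outerPart]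
  refine norm_integral_le_of_norm_le
    ((integrableOn_one_div_abs_rpow (by linarith) hδ).const_mul (2 * C))
    (Eventually.of_forall fun t => ?_)
  have h1 := abs_le.mp (hC (x + t • z))
  have h2 := abs_le.mp (hC x)
  have h3 : 0 ≤ |t| ^ (1 + 2 * s) := by positivity
  rw [Real.norm_eq_abs, abs_div, abs_of_nonneg h3, mul_one_div]
  gcongr
  exact abs_le.mpr ⟨by linarith, by linarith⟩

/-! ### Combinations of directional derivatives -/

/-- An operator on functions of the direction that is strictly decreasing on functions that are
bounded on the unit sphere. -/
def IsStrictlyDecreasing (A : (EuclideanSpace ℝ (Fin N) → ℝ) → ℝ) : Prop :=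
  ∀ (F G : EuclideanSpace ℝ (Fin N) → ℝ) (B c : ℝ), 0 < c →
    (∀ z, ‖z‖ = 1 → |F z| ≤ B) → (∀ z, ‖z‖ = 1 → |G z| ≤ B) →
    (∀ z, ‖z‖ = 1 → F z + c ≤ G z) → A G < A F

theorem ciInf_add_le_ciInf {ι : Type*} [Nonempty ι] {f g : ι → ℝ} {c : ℝ}
    (hf : BddBelow (range f)) (h : ∀ i, f i + c ≤ g i) : (⨅ i, f i) + c ≤ ⨅ i, g i :=
  le_ciInf fun i => (add_le_add_left (ciInf_le hf i) c).trans (h i)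

theorem ciSup_add_le_ciSup {ι : Type*} [Nonempty ι] {f g : ι → ℝ} {c : ℝ}
    (hg : BddAbove (range g)) (h : ∀ i, f i + c ≤ g i) : (⨆ i, f i) + c ≤ ⨆ i, g i :=
  le_sub_iff_add_le.mp (ciSup_le fun i => le_sub_iff_add_le.mpr ((h i).trans (le_ciSup hg i)))

theorem isStrictlyDecreasing_midRangeComb (hN : 1 ≤ N) :
    IsStrictlyDecreasing (midRangeComb (N := N)) := by
  intro F G B c hc hF hG h
  have : Nonempty (Fin N) := ⟨⟨0, hN⟩⟩
  have : Nonempty {z : EuclideanSpace ℝ (Fin N) // ‖z‖ = 1} := by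
    obtain ⟨z, hz⟩ := exists_norm_eq (EuclideanSpace ℝ (Fin N)) (zero_le_one' ℝ)
    exact ⟨⟨z, hz⟩⟩
  have h1 := ciInf_add_le_ciInf (f := fun z : {z : EuclideanSpace ℝ (Fin N) // ‖z‖ = 1} => F z)
    (g := fun z => G z) (c := c)
    ⟨-B, by rintro _ ⟨z, rfl⟩; exact (abs_le.mp (hF z z.2)).1⟩ fun z => h z z.2
  have h2 := ciSup_add_le_ciSup (f := fun z : {z : EuclideanSpace ℝ (Fin N) // ‖z‖ = 1} => F z)
    (g := fun z => G z) (c := c)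
    ⟨B, by rintro _ ⟨z, rfl⟩; exact (abs_le.mp (hG z z.2)).2⟩ fun z => h z z.2
  unfold midRangeComb
  linarith

theorem exists_submodule_finrank_eq {k : ℕ} (hk : k ≤ N) :
    ∃ S : Submodule ℝ (EuclideanSpace ℝ (Fin N)), Module.finrank ℝ S = k := by
  let b := (EuclideanSpace.basisFun (Fin N) ℝ).toBasis
  refine ⟨Submodule.span ℝ (range (b ∘ Fin.castLE hk)), ?_⟩
  simpa using finrank_span_eq_card (b.linearIndependent.comp _ (Fin.castLE_injective hk))

theorem isStrictlyDecreasing_traceComb (hN : 1 ≤ N) :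
    IsStrictlyDecreasing (traceComb (N := N)) := by
  intro F G B c hc hF hG h
  refine neg_lt_neg (Finset.sum_lt_sum_of_nonempty ⟨1, by simpa using hN⟩ fun i hi => ?_)
  rw [Finset.mem_Icc] at hi
  obtain ⟨S₀, hS₀⟩ := exists_submodule_finrank_eq (N := N) (k := N - i + 1) (by omega)
  have : Nonempty {S : Submodule ℝ (EuclideanSpace ℝ (Fin N)) //
    Module.finrank ℝ S = N - i + 1} := ⟨⟨S₀, hS₀⟩⟩
  have hne : ∀ S : {S : Submodule ℝ (EuclideanSpace ℝ (Fin N)) // Module.finrank ℝ S = N - i + 1},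
      Nonempty {z : EuclideanSpace ℝ (Fin N) // z ∈ S.1 ∧ ‖z‖ = 1} := by
    intro S
    have : Nontrivial S.1 := Module.nontrivial_of_finrank_pos (R := ℝ) (by rw [S.2]; omega)
    obtain ⟨z, hz⟩ := exists_norm_eq S.1 (zero_le_one' ℝ)
    exact ⟨⟨z, z.2, hz⟩⟩
  -- Real infima and suprema default to `0` on unbounded families; the bound `B` on the unit sphere
  -- keeps every sup-inf genuine.
  have hbdd : ∀ (H : EuclideanSpace ℝ (Fin N) → ℝ), (∀ z, ‖z‖ = 1 → |H z| ≤ B) →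
      ∀ S : Submodule ℝ (EuclideanSpace ℝ (Fin N)),
      BddBelow (range fun z : {z : EuclideanSpace ℝ (Fin N) // z ∈ S ∧ ‖z‖ = 1} => H z) :=
    fun H hH S => ⟨-B, by rintro _ ⟨z, rfl⟩; exact (abs_le.mp (hH z z.2.2)).1⟩
  refine lt_of_lt_of_le (lt_add_of_pos_right _ hc) (ciSup_add_le_ciSup ⟨B, ?_⟩ fun S => ?_)
  · rintro _ ⟨S, rfl⟩
    obtain ⟨z⟩ := hne S
    exact (ciInf_le (hbdd G hG S.1) z).trans (abs_le.mp (hG z z.2.2)).2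
  · have := hne S
    exact ciInf_add_le_ciInf (hbdd F hF S.1) fun z => h z z.2.2

/-! ### The comparison principle -/

/-- Integrates a pointwise comparison of increments: `α` is the gain beyond distance `a`, `β` the
error allowed beyond distance `b`. The gain lives inside `δ ≤ |t|` because `δ ≤ a`; the error set
may stick out, which costs only an inequality since `0 ≤ β`. -/
theorem outerPart_add_le {s δ : ℝ} (hs : 0 < s) (hδ : 0 < δ)
    {v u : EuclideanSpace ℝ (Fin N) → ℝ} (hv : Continuous v) (hu : Continuous u) {C : ℝ}
    (hCv : ∀ x, |v x| ≤ C) (hCu : ∀ x, |u x| ≤ C) {x y z : EuclideanSpace ℝ (Fin N)}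
    {a b α β : ℝ} (ha : δ ≤ a) (hb : 0 < b)
    (h : ∀ t : ℝ, δ ≤ |t| → v (x + t • z) - v x + {t : ℝ | a ≤ |t|}.indicator (fun _ => α) t ≤
      u (y + t • z) - u y + {t : ℝ | b ≤ |t|}.indicator (fun _ => β) t) (hβ : 0 ≤ β) :
    outerPart s δ v x z + α * ∫ t in {t : ℝ | a ≤ |t|}, 1 / |t| ^ (1 + 2 * s) ≤
      outerPart s δ u y z + β * ∫ t in {t : ℝ | b ≤ |t|}, 1 / |t| ^ (1 + 2 * s) := by
  set p := 1 + 2 * s with hp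
  have hp1 : 1 < p := by linarith
  have hind : ∀ (r γ : ℝ), (fun t : ℝ => {t : ℝ | r ≤ |t|}.indicator (fun t => γ * (1 / |t| ^ p)) t)
      = fun t => ({t : ℝ | r ≤ |t|}.indicator (fun _ => γ) t) / |t| ^ p := by
    intro r γ
    ext t
    by_cases ht : r ≤ |t| <;> simp [indicator, ht, div_eq_mul_inv]
  have hIi : ∀ r > 0, ∀ γ : ℝ,
      Integrable (fun t => ({t : ℝ | r ≤ |t|}.indicator (fun _ => γ) t) / |t| ^ p) := by
    intro r hr γ
    rw [← hind]
    exact (integrable_indicator_iff (measurableSet_le_abs r)).mpr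
      ((integrableOn_one_div_abs_rpow hp1 hr).const_mul γ)
  have hval : ∀ r γ : ℝ, γ * ∫ t in {t : ℝ | r ≤ |t|}, 1 / |t| ^ p =
      ∫ t, ({t : ℝ | r ≤ |t|}.indicator (fun _ => γ) t) / |t| ^ p := by
    intro r γ
    rw [← hind, integral_indicator (measurableSet_le_abs r), integral_const_mul]
  have hα : α * ∫ t in {t : ℝ | a ≤ |t|}, 1 / |t| ^ p =
      ∫ t in {t : ℝ | δ ≤ |t|}, ({t : ℝ | a ≤ |t|}.indicator (fun _ => α) t) / |t| ^ p := by
    rw [← hind, setIntegral_indicator (measurableSet_le_abs a), integral_const_mul]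
    congr 4
    ext t
    exact ⟨fun ht => ⟨ha.trans ht, ht⟩, fun ht => ht.2⟩
  have hβ' : ∫ t in {t : ℝ | δ ≤ |t|}, ({t : ℝ | b ≤ |t|}.indicator (fun _ => β) t) / |t| ^ p ≤
      β * ∫ t in {t : ℝ | b ≤ |t|}, 1 / |t| ^ p := by
    rw [hval]
    refine setIntegral_le_integral (hIi b hb β) (Eventually.of_forall fun t => ?_)
    exact div_nonneg (indicator_nonneg (fun _ _ => hβ) t) (by positivity)
  refine le_trans ?_ (add_le_add_right hβ' _)
  have hIv := integrableOn_outer hs hδ hv hCv x z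
  have hIu := integrableOn_outer hs hδ hu hCu y z
  rw [hα, outerPart, outerPart, ← integral_add hIv (hIi a (hδ.trans_le ha) α).integrableOn,
    ← integral_add hIu (hIi b hb β).integrableOn]
  refine setIntegral_mono_on (hIv.add (hIi a (hδ.trans_le ha) α).integrableOn)
    (hIu.add (hIi b hb β).integrableOn) (measurableSet_le_abs δ) fun t ht => ?_
  rw [← add_div, ← add_div]
  exact div_le_div_of_nonneg_right (h t ht) (by positivity)

/-- One finite `k` suffices, with no limit in the penalty: uniform continuity on the ball fixes the
distance at which `v` and `u` vary by less than `θ`, and `k` forces the maximum points closer than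
that. The last clause shifts both points by the same `d`, as the directional increments do. -/
theorem exists_max_doubling {v u : EuclideanSpace ℝ (Fin N) → ℝ} (hv : Continuous v)
    (hu : Continuous u) {C ρ θ M : ℝ} (hC : 0 ≤ C) (hCv : ∀ x, |v x| ≤ C) (hCu : ∀ x, |u x| ≤ C)
    (hθ : 0 < θ) (hM : 0 < M) {x₁ : EuclideanSpace ℝ (Fin N)} (hx₁ : ‖x₁‖ ≤ ρ)
    (hM₁ : M ≤ v x₁ - u x₁) :
    ∃ (k : ℝ) (x₀ y₀ : EuclideanSpace ℝ (Fin N)), 0 < k ∧ ‖x₀‖ ≤ ρ ∧ ‖y₀‖ ≤ ρ ∧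
      M ≤ v x₀ - u y₀ ∧
      (∀ x y, ‖x‖ ≤ ρ → ‖y‖ ≤ ρ →
        v x - u y - k * ‖x - y‖ ^ 2 ≤ v x₀ - u y₀ - k * ‖x₀ - y₀‖ ^ 2) ∧
      (∀ d, ‖x₀ + d‖ ≤ ρ → ‖y₀ + d‖ ≤ ρ → |v (x₀ + d) - v (y₀ + d)| < θ ∧
        |u (x₀ + d) - u (y₀ + d)| < θ) := by
  set K : Set (EuclideanSpace ℝ (Fin N)) := Metric.closedBall 0 ρ
  have hK : IsCompact K := isCompact_closedBall 0 ρ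
  have hmem : ∀ x, x ∈ K ↔ ‖x‖ ≤ ρ := fun x => mem_closedBall_zero_iff
  obtain ⟨η₁, hη₁, h₁⟩ := Metric.uniformContinuousOn_iff.mp
    (hK.uniformContinuousOn_of_continuous hv.continuousOn) θ hθ
  obtain ⟨η₂, hη₂, h₂⟩ := Metric.uniformContinuousOn_iff.mp
    (hK.uniformContinuousOn_of_continuous hu.continuousOn) θ hθ
  set η := min η₁ η₂
  have hη : 0 < η := lt_min hη₁ hη₂
  -- At distance `η` or more the penalty would be at least `2 * C + 1`, beyond the maximal possible
  -- value `2 * C` of `v x₀ - u y₀`, while the diagonal value is positive.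
  set k := (2 * C + 1) / η ^ 2 with hk
  have hk0 : 0 < k := by positivity
  obtain ⟨⟨x₀, y₀⟩, ⟨hx₀, hy₀⟩, hmax⟩ := (hK.prod hK).exists_isMaxOn
    (f := fun q => v q.1 - u q.2 - k * ‖q.1 - q.2‖ ^ 2)
    ⟨(x₁, x₁), (hmem x₁).mpr hx₁, (hmem x₁).mpr hx₁⟩ (by fun_prop)
  have hmax' : ∀ x y, ‖x‖ ≤ ρ → ‖y‖ ≤ ρ →
      v x - u y - k * ‖x - y‖ ^ 2 ≤ v x₀ - u y₀ - k * ‖x₀ - y₀‖ ^ 2 := fun x y hx hy =>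
    hmax (a := (x, y)) ⟨(hmem x).mpr hx, (hmem y).mpr hy⟩
  have hdiag := hmax' x₁ x₁ hx₁ hx₁
  simp only [sub_self, norm_zero, ne_eq, OfNat.ofNat_ne_zero, not_false_eq_true, zero_pow,
    mul_zero, sub_zero] at hdiag
  have hnn : 0 ≤ k * ‖x₀ - y₀‖ ^ 2 := by positivity
  have hclose : ‖x₀ - y₀‖ < η := by
    by_contra! hcon
    have h3 : 2 * C + 1 ≤ k * ‖x₀ - y₀‖ ^ 2 := by
      calc 2 * C + 1 = k * η ^ 2 := by rw [hk]; field_simp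
        _ ≤ _ := by gcongr
    have h4 := (abs_le.mp (hCv x₀)).2
    have h5 := (abs_le.mp (hCu y₀)).1
    linarith
  refine ⟨k, x₀, y₀, hk0, (hmem _).mp hx₀, (hmem _).mp hy₀, by linarith, hmax',
    fun d hx hy => ?_⟩
  have hd : dist (x₀ + d) (y₀ + d) < η := by rwa [dist_add_right, dist_eq_norm]
  exact ⟨h₁ _ ((hmem _).mpr hx) _ ((hmem _).mpr hy) (hd.trans_le (min_le_left _ _)),
    h₂ _ ((hmem _).mpr hx) _ ((hmem _).mpr hy) (hd.trans_le (min_le_right _ _))⟩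

theorem comparison_of_continuous {A : (EuclideanSpace ℝ (Fin N) → ℝ) → ℝ}
    (hA : IsStrictlyDecreasing A) {s : ℝ} (hs : 0 < s) (hs' : s < 1)
    {Ω : Set (EuclideanSpace ℝ (Fin N))} (hΩ : Bornology.IsBounded Ω)
    {v u : EuclideanSpace ℝ (Fin N) → ℝ} (hv : Continuous v) (hu : Continuous u)
    (hvb : ∃ C : ℝ, ∀ x, |v x| ≤ C) (hub : ∃ C : ℝ, ∀ x, |u x| ≤ C)
    (hsub : ∀ δ : ℝ, 0 < δ → ∀ φ : EuclideanSpace ℝ (Fin N) → ℝ, ContDiff ℝ 2 φ →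
      ∀ x₀ ∈ Ω, IsMaxOn (fun y => v y - φ y) (Metric.ball x₀ δ) x₀ → A (dirEval s δ v φ x₀) ≤ 0)
    (hsup : ∀ δ : ℝ, 0 < δ → ∀ φ : EuclideanSpace ℝ (Fin N) → ℝ, ContDiff ℝ 2 φ →
      ∀ x₀ ∈ Ω, IsMinOn (fun y => u y - φ y) (Metric.ball x₀ δ) x₀ → 0 ≤ A (dirEval s δ u φ x₀))
    (hout : ∀ x ∉ Ω, v x ≤ u x) (x : EuclideanSpace ℝ (Fin N)) : v x ≤ u x := by
  by_contra! hx
  obtain ⟨C₁, hC₁⟩ := hvb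
  obtain ⟨C₂, hC₂⟩ := hub
  set C := max C₁ C₂
  have hCv : ∀ x, |v x| ≤ C := fun x => (hC₁ x).trans (le_max_left _ _)
  have hCu : ∀ x, |u x| ≤ C := fun x => (hC₂ x).trans (le_max_right _ _)
  have hC : 0 ≤ C := (abs_nonneg _).trans (hCv x)
  set M := v x - u x with hMdef
  have hM : 0 < M := sub_pos.mpr hx
  have hxΩ : x ∈ Ω := by
    by_contra h
    exact absurd (hout x h) (not_le.mpr hx)
  obtain ⟨R, hR, hΩR⟩ : ∃ R : ℝ, 1 ≤ R ∧ ∀ y ∈ Ω, ‖y‖ < R := by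
    obtain ⟨R, hR⟩ := hΩ.exists_norm_le
    exact ⟨max (R + 1) 1, le_max_right _ _,
      fun y hy => ((hR y hy).trans_lt (lt_add_one R)).trans_le (le_max_left _ _)⟩
  have hp1 : 1 < 1 + 2 * s := by linarith
  have hJ : 0 < ∫ t in {t : ℝ | 2 * R ≤ |t|}, 1 / |t| ^ (1 + 2 * s) :=
    setIntegral_le_abs_pos hp1 (by linarith)
  set J := ∫ t in {t : ℝ | 2 * R ≤ |t|}, 1 / |t| ^ (1 + 2 * s) with hJdef
  -- A quarter of the gain `M / 2 * J`: one `c` pays for the tail beyond `n`, one for the quadratic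
  -- test functions, and at least `c` is left for strictness.
  set c := M / 8 * J with hc
  have hc0 : 0 < c := by positivity
  obtain ⟨n, hn, hn1⟩ : ∃ n : ℕ, (2 * C + M / 2) *
      (∫ t in {t : ℝ | (n : ℝ) ≤ |t|}, 1 / |t| ^ (1 + 2 * s)) < c ∧ 1 ≤ n := by
    have h := (tendsto_setIntegral_le_abs hp1).const_mul (2 * C + M / 2)
    rw [mul_zero] at h
    exact ((h.eventually_lt_const hc0).and (eventually_ge_atTop 1)).exists
  have hn0 : (0 : ℝ) < n := by exact_mod_cast hn1
  -- The radius contains every `x₀ + t • z` and `y₀ + t • z` with `|t| < n`, and the test balls of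
  -- radius `δ < 1`. It depends on `n`, so `n` precedes `k`, and `δ` is chosen last, in terms of
  -- `k`.
  obtain ⟨k, x₀, y₀, hk, hx₀, hy₀, hM₀, hmax, hclose⟩ := exists_max_doubling hv hu
    (ρ := R + n + 1) (θ := M / 2) hC hCv hCu (by positivity) hM
    (by linarith [hΩR x hxΩ]) hMdef.le
  have hx₀Ω : x₀ ∈ Ω := by
    by_contra h
    have h1 := hout x₀ h
    have h2 := (abs_lt.mp (hclose 0 (by simpa using hx₀) (by simpa using hy₀)).2).2
    rw [add_zero, add_zero] at h2
    linarith
  have hy₀Ω : y₀ ∈ Ω := by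
    by_contra h
    have h1 := hout y₀ h
    have h2 := (abs_lt.mp (hclose 0 (by simpa using hx₀) (by simpa using hy₀)).1).2
    rw [add_zero, add_zero] at h2
    linarith
  obtain ⟨δ, ⟨hδ, hδ1⟩, hKδ⟩ : ∃ δ : ℝ, δ ∈ Ioo (0 : ℝ) 1 ∧
      (2 * k) * (∫ t in {t : ℝ | |t| < δ}, t ^ 2 / |t| ^ (1 + 2 * s)) < c := by
    have h := (tendsto_setIntegral_abs_lt (p := 1 + 2 * s) (by linarith)).const_mul (2 * k)
    rw [mul_zero] at h
    have hIoo : ∀ᶠ δ : ℝ in 𝓝[>] 0, δ ∈ Ioo (0 : ℝ) 1 := Ioo_mem_nhdsGT one_pos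
    exact (hIoo.and (h.eventually_lt_const hc0)).exists
  set κ := ∫ t in {t : ℝ | |t| < δ}, t ^ 2 / |t| ^ (1 + 2 * s) with hκ
  have hball : ∀ a ∈ Ω, ∀ y ∈ Metric.ball a δ, ‖y‖ ≤ R + n + 1 := by
    intro a ha y hy
    have h1 := hΩR a ha
    have h2 : ‖y - a‖ < δ := by simpa [dist_eq_norm] using hy
    have h3 := norm_sub_norm_le y a
    linarith
  set φ : EuclideanSpace ℝ (Fin N) → ℝ := fun w => 0 + k * ‖w - y₀‖ ^ 2 with hφ
  set ψ : EuclideanSpace ℝ (Fin N) → ℝ := fun w => 0 + (-k) * ‖w - x₀‖ ^ 2 with hψ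
  have hsmooth : ∀ (a : ℝ) (y : EuclideanSpace ℝ (Fin N)),
      ContDiff ℝ 2 fun w => 0 + a * ‖w - y‖ ^ 2 := fun a y =>
    contDiff_const.add (contDiff_const.mul ((contDiff_id.sub contDiff_const).norm_sq ℝ))
  have h1 := hsub δ hδ φ (hsmooth k y₀) x₀ hx₀Ω fun y hy => by
    have := hmax y y₀ (hball x₀ hx₀Ω y hy) hy₀
    simp only [mem_ofPred_eq, hφ]
    linarith
  have h2 := hsup δ hδ ψ (hsmooth (-k) x₀) y₀ hy₀Ω fun y hy => by
    have := hmax x₀ y hx₀ (hball y₀ hy₀Ω y hy)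
    rw [norm_sub_rev x₀ y, norm_sub_rev x₀ y₀] at this
    simp only [mem_ofPred_eq, hψ]
    linarith
  have hFv : ∀ z, ‖z‖ = 1 → dirEval s δ v φ x₀ z = k * κ + outerPart s δ v x₀ z := fun z hz => by
    rw [dirEval, hφ, innerPart_sq_dist hs' k 0 x₀ y₀ z hz]
  have hGu : ∀ z, ‖z‖ = 1 → dirEval s δ u ψ y₀ z = (-k) * κ + outerPart s δ u y₀ z :=
    fun z hz => by rw [dirEval, hψ, innerPart_sq_dist hs' (-k) 0 y₀ x₀ z hz]
  have hB : ∀ (w : EuclideanSpace ℝ (Fin N) → ℝ) (_ : ∀ x, |w x| ≤ C) (l : ℝ) (_ : |l| ≤ k)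
      (y z : EuclideanSpace ℝ (Fin N)), |l * κ + outerPart s δ w y z| ≤ k * |κ| +
        2 * C * ∫ t in {t : ℝ | δ ≤ |t|}, 1 / |t| ^ (1 + 2 * s) := by
    intro w hw l hl y z
    refine (abs_add_le _ _).trans (add_le_add ?_ (abs_outerPart_le hs hδ hw y z))
    rw [abs_mul]
    gcongr
  refine absurd (hA (dirEval s δ v φ x₀) (dirEval s δ u ψ y₀) _ c hc0
    (fun z hz => by rw [hFv z hz]; exact hB v hCv k (abs_of_pos hk).le x₀ z)
    (fun z hz => by rw [hGu z hz]; exact hB u hCu (-k) (by rw [abs_neg, abs_of_pos hk]) y₀ z)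
    fun z hz => ?_) (not_lt.mpr (h1.trans h2))
  have hmain := outerPart_add_le (s := s) hs hδ hv hu hCv hCu (x := x₀) (y := y₀) (z := z)
    (a := 2 * R) (b := n) (α := M / 2) (β := 2 * C + M / 2) (by linarith) hn0 (fun t _ => ?_)
    (by positivity)
  · rw [hFv z hz, hGu z hz]
    rw [← hJdef] at hmain
    linarith
  have hnorm : ‖t • z‖ = |t| := by rw [norm_smul, hz, mul_one, Real.norm_eq_abs]
  have hvt := (abs_le.mp (hCv (x₀ + t • z))).2
  have hut := (abs_le.mp (hCu (y₀ + t • z))).1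
  have hαle : {t : ℝ | 2 * R ≤ |t|}.indicator (fun _ => M / 2) t ≤ M / 2 :=
    indicator_le_self' (fun _ _ => by positivity) t
  -- Three ranges of `|t|`: beyond `n` only boundedness is used; between `2 * R` and `n` the line is
  -- off `Ω` and gains `M / 2`; below `2 * R` maximality alone applies.
  by_cases hnt : (n : ℝ) ≤ |t|
  · rw [indicator_of_mem (s := {t : ℝ | (n : ℝ) ≤ |t|}) hnt]
    linarith
  · rw [indicator_of_notMem (s := {t : ℝ | (n : ℝ) ≤ |t|}) hnt]
    push Not at hnt
    have hxK : ‖x₀ + t • z‖ ≤ R + n + 1 := by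
      linarith [norm_add_le x₀ (t • z), hΩR x₀ hx₀Ω]
    have hyK : ‖y₀ + t • z‖ ≤ R + n + 1 := by
      linarith [norm_add_le y₀ (t • z), hΩR y₀ hy₀Ω]
    by_cases hRt : 2 * R ≤ |t|
    · rw [indicator_of_mem (s := {t : ℝ | 2 * R ≤ |t|}) hRt]
      have hoff : x₀ + t • z ∉ Ω := fun hmem => by
        have h3 := hΩR _ hmem
        have h4 := hΩR _ hx₀Ω
        have h5 : ‖t • z‖ ≤ ‖x₀ + t • z‖ + ‖x₀‖ := by
          simpa using norm_sub_le (x₀ + t • z) x₀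
        linarith
      have h3 := hout _ hoff
      have h4 := (abs_lt.mp (hclose (t • z) hxK hyK).2).2
      linarith
    · rw [indicator_of_notMem (s := {t : ℝ | 2 * R ≤ |t|}) hRt]
      have h3 := hmax _ _ hxK hyK
      rw [add_sub_add_right_eq_sub] at h3
      linarith

/-! ### Continuity of solutions and the boundary values -/

/-- A boundary point interior to `closure Ω` would have `ρ ≤ 0` all around it and `ρ ≥ 0` at it,
hence be a local maximum of `ρ`, against the non-vanishing derivative. -/
theorem IsBoundedC2Domain.compl_subset_closure {Ω : Set (EuclideanSpace ℝ (Fin N))}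
    (hΩ : IsBoundedC2Domain Ω) : Ωᶜ ⊆ closure (closure Ω)ᶜ := by
  intro x hx
  rw [closure_compl]
  intro hint
  have hfr : x ∈ frontier Ω := by
    rw [hΩ.isOpen.frontier_eq]
    exact ⟨interior_subset hint, hx⟩
  obtain ⟨U, ρ, hU, hxU, hρ, hρ', hUΩ⟩ := hΩ.c2_boundary x hfr
  have hx0 : 0 ≤ ρ x := by
    by_contra! h
    have : x ∈ Ω ∩ U := hUΩ ▸ ⟨hxU, h⟩
    exact hx this.1
  refine hρ' x hxU (IsLocalMax.fderiv_eq_zero ?_)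
  filter_upwards [mem_interior_iff_mem_nhds.mp hint, hU.mem_nhds hxU] with y hy hyU
  refine le_trans ?_ hx0
  by_contra! hpos
  have hopen : IsOpen (U ∩ ρ ⁻¹' Ioi 0) := hρ.continuousOn.isOpen_inter_preimage hU isOpen_Ioi
  obtain ⟨w, ⟨hwU, hw0⟩, hwΩ⟩ := mem_closure_iff.mp hy _ hopen ⟨hyU, hpos⟩
  have hw : w ∈ {x ∈ U | ρ x < 0} := hUΩ ▸ ⟨hwΩ, hwU⟩
  exact absurd hw.2 (not_lt.mpr (le_of_lt hw0))

section Solutions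

variable {A : (EuclideanSpace ℝ (Fin N) → ℝ) → ℝ} {s : ℝ} {Ω : Set (EuclideanSpace ℝ (Fin N))}
  {g u : EuclideanSpace ℝ (Fin N) → ℝ}

theorem continuous_of_solution (h : IsViscositySubsolution A s Ω g u)
    (h' : IsViscositySupersolution A s Ω g u) : Continuous u :=
  continuous_iff_lower_upperSemicontinuous.mpr ⟨h'.lowerSemicontinuous, h.upperSemicontinuous⟩

theorem eqOn_compl_of_solution (hΩ : IsBoundedC2Domain Ω) (hg : IsExteriorDatum Ω g)
    (h : IsViscositySubsolution A s Ω g u) (h' : IsViscositySupersolution A s Ω g u) :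
    EqOn u g Ωᶜ :=
  EqOn.of_subset_closure (s := (closure Ω)ᶜ)
    (fun x hx => le_antisymm (h.le_exterior x hx) (h'.ge_exterior x hx))
    (continuous_of_solution h h').continuousOn hg.continuousOn
    (compl_subset_compl.mpr subset_closure) hΩ.compl_subset_closure

theorem upperExt_eq_self (h : EqOn u g Ωᶜ) : upperExt Ω g u = u := by
  ext x
  by_cases hx : x ∈ Ω
  · simp [upperExt, hx]
  · simp [upperExt, hx, h hx]

theorem lowerExt_eq_self (h : EqOn u g Ωᶜ) : lowerExt Ω g u = u := by
  ext x
  by_cases hx : x ∈ Ω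
  · simp [lowerExt, hx]
  · simp [lowerExt, hx, h hx]

variable {g₁ g₂ u₁ u₂ : EuclideanSpace ℝ (Fin N) → ℝ}

/-- Comparison up to an additive constant. -/
theorem solution_le_add_const (hA : IsStrictlyDecreasing A) (hs : 0 < s) (hs' : s < 1)
    (hΩ : IsBoundedC2Domain Ω) (hg₁ : IsExteriorDatum Ω g₁) (hg₂ : IsExteriorDatum Ω g₂)
    (h₁ : IsViscositySubsolution A s Ω g₁ u₁ ∧ IsViscositySupersolution A s Ω g₁ u₁)
    (h₂ : IsViscositySubsolution A s Ω g₂ u₂ ∧ IsViscositySupersolution A s Ω g₂ u₂) {D : ℝ}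
    (hD : ∀ x ∉ Ω, u₂ x ≤ u₁ x + D) (x : EuclideanSpace ℝ (Fin N)) : u₂ x ≤ u₁ x + D := by
  have hu₂ := upperExt_eq_self (eqOn_compl_of_solution hΩ hg₂ h₂.1 h₂.2)
  have hu₁ := lowerExt_eq_self (eqOn_compl_of_solution hΩ hg₁ h₁.1 h₁.2)
  refine comparison_of_continuous (u := fun x => u₁ x + D) hA hs hs' hΩ.isBounded
    (continuous_of_solution h₂.1 h₂.2)
    ((continuous_of_solution h₁.1 h₁.2).add continuous_const) h₂.1.bounded ?_ ?_ ?_ hD x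
  · obtain ⟨C, hC⟩ := h₁.1.bounded
    exact ⟨C + |D|, fun x => (abs_add_le _ _).trans (add_le_add_left (hC x) _)⟩
  · intro δ hδ φ hφ x₀ hx₀ hmax
    have := h₂.1.interior_test δ hδ φ hφ x₀ hx₀ hmax
    rwa [hu₂] at this
  · intro δ hδ φ hφ x₀ hx₀ hmin
    have := h₁.2.interior_test δ hδ φ hφ x₀ hx₀ fun y hy => by
      have h := hmin hy
      simp only [mem_ofPred_eq] at h ⊢
      linarith
    rw [hu₁] at this
    have he : dirEval s δ (fun x => u₁ x + D) φ x₀ = dirEval s δ u₁ φ x₀ := by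
      ext z
      simp [dirEval, outerPart]
    rwa [he]

theorem solution_mono_and_eLpNorm_le (hA : IsStrictlyDecreasing A) (hs : 0 < s) (hs' : s < 1)
    (hΩ : IsBoundedC2Domain Ω) (hg₁ : IsExteriorDatum Ω g₁) (hg₂ : IsExteriorDatum Ω g₂)
    (h₁ : IsViscositySubsolution A s Ω g₁ u₁ ∧ IsViscositySupersolution A s Ω g₁ u₁)
    (h₂ : IsViscositySubsolution A s Ω g₂ u₂ ∧ IsViscositySupersolution A s Ω g₂ u₂) :
    ((∀ x ∈ Ωᶜ, g₂ x ≤ g₁ x) → ∀ x, u₂ x ≤ u₁ x) ∧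
    eLpNorm (fun x => u₁ x - u₂ x) ⊤ (volume.restrict Ω) ≤
      eLpNorm (fun x => g₁ x - g₂ x) ⊤ (volume.restrict Ωᶜ) := by
  have he₁ := eqOn_compl_of_solution hΩ hg₁ h₁.1 h₁.2
  have he₂ := eqOn_compl_of_solution hΩ hg₂ h₂.1 h₂.2
  refine ⟨fun hg x => ?_, ?_⟩
  · simpa using solution_le_add_const hA hs hs' hΩ hg₁ hg₂ h₁ h₂ (D := 0)
      (fun y hy => by simpa [he₁ hy, he₂ hy] using hg y hy) x
  rw [eLpNorm_exponent_top, eLpNorm_exponent_top]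
  set D := eLpNormEssSup (fun x => g₁ x - g₂ x) (volume.restrict Ωᶜ) with hD
  rcases eq_or_ne D ⊤ with htop | htop
  · rw [htop]; exact le_top
  have hae : ∀ᵐ x ∂(volume.restrict Ωᶜ), |g₁ x - g₂ x| ≤ D.toReal := by
    filter_upwards [enorm_ae_le_eLpNormEssSup (fun x => g₁ x - g₂ x) (volume.restrict Ωᶜ)]
      with x hx
    rw [← Real.norm_eq_abs, ← toReal_enorm]
    exact ENNReal.toReal_mono htop hx
  -- The essential bound must become pointwise, also on the boundary. By continuity a violation is
  -- open, so it meets the open set `(closure Ω)ᶜ` in positive measure.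
  have hbound : ∀ x ∉ Ω, |u₁ x - u₂ x| ≤ D.toReal := by
    intro x hx
    by_contra! hlt
    have hopen : IsOpen {y | D.toReal < |u₁ y - u₂ y|} :=
      isOpen_lt continuous_const
        ((continuous_of_solution h₁.1 h₁.2).sub (continuous_of_solution h₂.1 h₂.2)).abs
    have hne := mem_closure_iff.mp (hΩ.compl_subset_closure hx) _ hopen hlt
    refine ((hopen.inter isClosed_closure.isOpen_compl).measure_pos volume hne).ne' ?_
    rw [ae_restrict_iff' hΩ.isOpen.measurableSet.compl] at hae
    refine measure_mono_null (fun y hy => ?_) hae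
    have hyΩ : y ∈ Ωᶜ := fun h => hy.2 (subset_closure h)
    intro h
    have h3 := h hyΩ
    rw [← he₁ hyΩ, ← he₂ hyΩ] at h3
    exact absurd h3 (not_le.mpr hy.1)
  refine (eLpNormEssSup_le_of_ae_bound (C := D.toReal) (Eventually.of_forall fun x => ?_)).trans
    (ENNReal.ofReal_toReal htop).le
  have h3 := solution_le_add_const hA hs hs' hΩ hg₁ hg₂ h₁ h₂ (D := D.toReal)
    (fun y hy => by linarith [(abs_le.mp (hbound y hy)).1]) x
  have h4 := solution_le_add_const hA hs hs' hΩ hg₂ hg₁ h₂ h₁ (D := D.toReal)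
    (fun y hy => by linarith [(abs_le.mp (hbound y hy)).2]) x
  exact abs_le.mpr ⟨by linarith, by linarith⟩

end Solutions

end FracTrace

theorem mainTheorem7 {N : ℕ} (hN : 1 ≤ N) {s : ℝ} (hs : 1 / 2 < s) (hs' : s < 1)
    {Ω : Set (EuclideanSpace ℝ (Fin N))} (hΩ : FracTrace.IsBoundedC2Domain Ω)
    {g₁ g₂ : EuclideanSpace ℝ (Fin N) → ℝ}
    (hg₁ : FracTrace.IsExteriorDatum Ω g₁) (hg₂ : FracTrace.IsExteriorDatum Ω g₂)
    {u₁ u₂ : EuclideanSpace ℝ (Fin N) → ℝ}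
    (hu : (FracTrace.IsTraceSolution s Ω g₁ u₁ ∧ FracTrace.IsTraceSolution s Ω g₂ u₂) ∨
      (FracTrace.IsMidRangeSolution s Ω g₁ u₁ ∧ FracTrace.IsMidRangeSolution s Ω g₂ u₂)) :
    ((∀ x ∈ Ωᶜ, g₂ x ≤ g₁ x) → ∀ x, u₂ x ≤ u₁ x) ∧
    eLpNorm (fun x => u₁ x - u₂ x) ⊤ (volume.restrict Ω) ≤
      eLpNorm (fun x => g₁ x - g₂ x) ⊤ (volume.restrict Ωᶜ) := by
  have hs0 : 0 < s := by linarith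
  rcases hu with ⟨h₁, h₂⟩ | ⟨h₁, h₂⟩
  · exact FracTrace.solution_mono_and_eLpNorm_le (FracTrace.isStrictlyDecreasing_traceComb hN)
      hs0 hs' hΩ hg₁ hg₂ h₁ h₂
  · exact FracTrace.solution_mono_and_eLpNorm_le (FracTrace.isStrictlyDecreasing_midRangeComb hN)
      hs0 hs' hΩ hg₁ hg₂ h₁ h₂
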